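/- Let $\mathcal H$ be a separable complex Hilbert space, and let $z\mapsto V(z)$ be an irreducible, strongly continuous, projective unitary representation of the group $\mathbb R^{2d}$ on $\mathcal H$ ($\mathcal H\neq\{0\}$) satisfying the Weyl--Segal commutation relations $$V(z)V(z')=e^{\frac i2\Delta(z,z')}V(z+z'),\qquad \Delta(z,z')=\sum_{k=1}^d(x_ky_k'-y_kx_k'),$$ for $z=(x_1,y_1,\dots,x_d,y_d)$ and $z'=(x_1',y_1',\dots,x_d',y_d')$ in $\mathbb R^{2d}$. A probability operator is a positive operator $T$ on $\mathcal H$ with $\operatorname{tr}T=1$; its characteristic function is $\widehat T(z)=\operatorname{tr}\,TV(z)$, $z\in\mathbb R^{2d}$. A sequence $\{A_n\}_{n\ge1}$ of real $2d\times 2d$ matrices is called admissible if, for each $n\ge 1$ and any probability operators $T_1,\dots,T_n$, the function $z\mapsto\prod_{k=1}^n\widehat T_k(A_nz)$ is the characteristic function of some probability operator. Let $a_k^{(n)}\ge 0$ ($n\ge 1$, $k=1,\dots,d$) be real numbers such that the sequence of diagonal matrices $$A_n=\operatorname{diag}\bigl(a_1^{(n)},a_1^{(n)},a_2^{(n)},a_2^{(n)},\dots,a_d^{(n)},a_d^{(n)}\bigr),\qquad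 n\ge1,$$ is admissible. Then $$a_k^{(n)}\ge\frac1{\sqrt n}\qquad\text{for all } n\ge1 \text{ and } k=1,\dots,d.$$ -/

import Mathlib

namespace QuantumLimit

noncomputable section

/-- The phase space `ℝ^{2d}`: a vector `z = (x₁, y₁, …, x_d, y_d)` has the coordinates
`x_k = z (k, 0)` and `y_k = z (k, 1)`. -/
abbrev PhaseSpace (d : ℕ) : Type := Fin d × Fin 2 → ℝ

/-- The symplectic form `Δ(z, z') = ∑ₖ (x_k y'_k - y_k x'_k)`. -/
def symp {d : ℕ} (z z' : PhaseSpace d) : ℝ :=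
  ∑ k : Fin d, (z (k, 0) * z' (k, 1) - z (k, 1) * z' (k, 0))

section Operators

variable {H : Type*} [NormedAddCommGroup H] [InnerProductSpace ℂ H] [CompleteSpace H]

variable (H) in
/-- The index set of a fixed orthonormal basis of `H`. -/
def basisIndex : Set H := (exists_hilbertBasis ℂ H).choose

variable (H) in
/-- A fixed orthonormal basis of `H`, used to compute traces. -/
def onb : HilbertBasis (basisIndex H) ℂ H := (exists_hilbertBasis ℂ H).choose_spec.choose

/-- The trace `tr A = ∑ᵢ ⟨eᵢ, A eᵢ⟩`. For positive operators and for trace-class operators it does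
not depend on the orthonormal basis; it is used below only for operators `T V` with `T` positive
of trace one and `V` unitary, which are trace class. -/
def trace (A : H →L[ℂ] H) : ℂ := ∑' i, inner ℂ (onb H i) (A (onb H i))

/-- A probability operator: a positive operator of unit trace. The convergence of the series that
defines the trace is part of the definition. -/
def IsProbabilityOperator (T : H →L[ℂ] H) : Prop :=
  T.IsPositive ∧ HasSum (fun i => inner ℂ (onb H i) (T (onb H i))) (1 : ℂ)

/-- An irreducible, strongly continuous, projective unitary representation of `ℝ^{2d}` on `H`
satisfying the Weyl-Segal commutation relations `V(z) V(z') = e^{(i/2) Δ(z, z')} V(z + z')`.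
Irreducibility: `H ≠ 0`, and `0` and `H` are the only closed invariant subspaces. -/
structure IsIrreducibleWeylRep {d : ℕ} (V : PhaseSpace d → H →L[ℂ] H) : Prop where
  mem_unitary : ∀ z, V z ∈ unitary (H →L[ℂ] H)
  weyl_segal : ∀ z z',
    V z * V z' = Complex.exp (Complex.I / 2 * (symp z z' : ℂ)) • V (z + z')
  continuous : ∀ ψ : H, Continuous fun z => V z ψ
  nontrivial : Nontrivial H
  irreducible : ∀ K : Submodule ℂ H, IsClosed (K : Set H) →
    (∀ z, ∀ ψ ∈ K, V z ψ ∈ K) → K = ⊥ ∨ K = ⊤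

/-- The characteristic function `T̂(z) = tr (T V(z))`. -/
def charFn {d : ℕ} (V : PhaseSpace d → H →L[ℂ] H) (T : H →L[ℂ] H) (z : PhaseSpace d) : ℂ :=
  trace (T * V z)

/-- Admissibility of a sequence `A₁, A₂, …` of `2d × 2d` matrices: for each `n ≥ 1` and any
probability operators `T₁, …, T_n`, the function `z ↦ ∏ₖ T̂ₖ(A_n z)` is the characteristic
function of some probability operator. (The entry `A 0` plays no role.) -/
def IsAdmissible {d : ℕ} (V : PhaseSpace d → H →L[ℂ] H)
    (A : ℕ → Matrix (Fin d × Fin 2) (Fin d × Fin 2) ℝ) : Prop :=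
  ∀ n : ℕ, 1 ≤ n → ∀ T : Fin n → H →L[ℂ] H, (∀ k, IsProbabilityOperator (T k)) →
    ∃ S : H →L[ℂ] H, IsProbabilityOperator S ∧
      ∀ z : PhaseSpace d, charFn V S z = ∏ k, charFn V (T k) ((A n).mulVec z)

end Operators

/-- The block-diagonal matrix `diag(a₁, a₁, a₂, a₂, …, a_d, a_d)`. -/
def normingMatrix {d : ℕ} (a : Fin d → ℝ) : Matrix (Fin d × Fin 2) (Fin d × Fin 2) ℝ :=
  Matrix.diagonal fun p => a p.1

end

end QuantumLimit

/-!
The idea is to test admissibility on copies of the vacuum state of one mode. Fix a mode `k`. The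
restriction `W` of `V` to the phase plane of that mode is a strongly continuous solution of the
Weyl–Segal relations in one degree of freedom (`IsWeylSystem`). Following von Neumann, consider
`P = (2π)⁻¹ ∫ e^{-|z|²/4} W(z) dz`. A Gaussian integral gives `P W(w) P = e^{-|w|²/4} P`
(`vacuumProj_apply_apply_vacuumProj`), so `P` is an orthogonal projection. It is nonzero by Fourier
inversion (`vacuumProj_ne_zero`), and a unit vector `ψ` in its range satisfies
`⟨ψ, W(w) ψ⟩ = e^{-|w|²/4}` (`exists_vacuum`).

Take all `T_j` equal to the projection onto `ψ`. Admissibility yields a probability operator `S`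
with `tr S W(w) = e^{-c|w|²/4}`, where `c = n (a_k^{(n)})²`. Integrating against the kernel of `P`
gives `tr S P = 2 / (1 + c)`. Since `‖P‖ ≤ 1`, the left side is at most `1`, so `c ≥ 1`
(`one_le_of_trace_eq_gaussian`), which is the claim.

The trace is given as a sum over a fixed orthonormal basis. The estimate
`∑ᵢ |⟨eᵢ, S B eᵢ⟩| ≤ 1` for a probability operator `S` and a contraction `B`
(`tsum_enorm_inner_mul_le`) supplies both `|tr S P| ≤ 1` and the interchange
of trace and integral (`trace_mul_eq_integral`).
-/

namespace QuantumLimit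

open MeasureTheory
open scoped ENNReal

/-! ### Traces against probability operators -/

section Trace

variable {H : Type*} [NormedAddCommGroup H] [InnerProductSpace ℂ H]

theorem enorm_sq_eq_tsum_enorm_inner_sq {ι : Type*} (b : HilbertBasis ι ℂ H) (x : H) :
    ‖x‖ₑ ^ 2 = ∑' i, ‖(inner ℂ (b i) x : ℂ)‖ₑ ^ 2 := by
  have h := b.hasSum_inner_mul_inner x x
  have h2 : HasSum (fun i => ‖(inner ℂ (b i) x : ℂ)‖ ^ 2) (‖x‖ ^ 2) := by
    rw [← Complex.hasSum_ofReal]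
    convert! h using 1
    · ext i
      rw [← inner_conj_symm x (b i), ← Complex.normSq_eq_conj_mul_self, Complex.normSq_eq_norm_sq]
    · rw [inner_self_eq_norm_sq_to_K]; simp
  have h3 := ENNReal.ofReal_tsum_of_nonneg (fun i => by positivity) h2.summable
  rw [h2.tsum_eq] at h3
  simpa [ENNReal.ofReal_pow, ofReal_norm] using h3

theorem enorm_inner_le_half_add_sq (x y : H) :
    ‖(inner ℂ x y : ℂ)‖ₑ ≤ (‖x‖ₑ ^ 2 + ‖y‖ₑ ^ 2) / 2 := by
  have h : ‖(inner ℂ x y : ℂ)‖ ≤ (‖x‖ ^ 2 + ‖y‖ ^ 2) / 2 := by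
    nlinarith [norm_inner_le_norm (𝕜 := ℂ) x y, sq_nonneg (‖x‖ - ‖y‖)]
  have h2 := ENNReal.ofReal_le_ofReal h
  rw [ENNReal.ofReal_div_of_pos two_pos, ENNReal.ofReal_add (by positivity) (by positivity)] at h2
  simpa [ENNReal.ofReal_pow, ofReal_norm] using h2

theorem _root_.Orthonormal.countable_of_separableSpace [TopologicalSpace.SeparableSpace H]
    {ι : Type*} {v : ι → H} (hv : Orthonormal ℂ v) : Countable ι := by
  have hdist : Pairwise fun i j =>
      Disjoint (Metric.ball (v i) (1 / 2)) (Metric.ball (v j) (1 / 2)) := by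
    intro i j hij
    refine Metric.ball_disjoint_ball ?_
    rw [dist_eq_norm]
    have h := norm_sub_sq (𝕜 := ℂ) (v i) (v j)
    rw [hv.2 hij, hv.1, hv.1] at h
    simp at h
    nlinarith [norm_nonneg (v i - v j)]
  exact Pairwise.countable_of_isOpen_disjoint hdist (fun i => Metric.isOpen_ball)
    (fun i => ⟨v i, Metric.mem_ball_self (by norm_num)⟩)

variable [CompleteSpace H]

/-- The Hilbert–Schmidt norms of an operator and of its adjoint agree. -/
theorem tsum_enorm_sq_adjoint {ι : Type*} (b : HilbertBasis ι ℂ H) (A : H →L[ℂ] H) :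
    ∑' i, ‖A (b i)‖ₑ ^ 2 = ∑' i, ‖A.adjoint (b i)‖ₑ ^ 2 := by
  simp_rw [enorm_sq_eq_tsum_enorm_inner_sq b]
  rw [ENNReal.tsum_comm]
  refine tsum_congr fun j => tsum_congr fun i => ?_
  rw [ContinuousLinearMap.adjoint_inner_right, ← ofReal_norm, ← ofReal_norm, norm_inner_symm]

/-- The trace-class estimate `|tr (S B)| ≤ ‖S‖₁ ‖B‖`, with absolute convergence: writing
`S = R²` with `R` self-adjoint, `⟨eᵢ, S B eᵢ⟩ = ⟨R eᵢ, R B eᵢ⟩`, and both `R` and `R B` have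
Hilbert–Schmidt norm at most one. -/
theorem IsProbabilityOperator.tsum_enorm_inner_mul_le {S : H →L[ℂ] H}
    (hS : IsProbabilityOperator S) {B : H →L[ℂ] H} (hB : ‖B‖ ≤ 1) :
    ∑' i, ‖(inner ℂ (onb H i) ((S * B) (onb H i)) : ℂ)‖ₑ ≤ 1 := by
  obtain ⟨hpos, hsum⟩ := hS
  have hS0 : 0 ≤ S := (ContinuousLinearMap.nonneg_iff_isPositive S).2 hpos
  set R : H →L[ℂ] H := CFC.sqrt S with hR
  have hRR : R * R = S := CFC.sqrt_mul_sqrt_self S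
  have hRadj : R.adjoint = R :=
    ((ContinuousLinearMap.nonneg_iff_isPositive R).1 (CFC.sqrt_nonneg S)).isSelfAdjoint
  have hinner : ∀ x y : H, inner ℂ x (S y) = (inner ℂ (R x) (R y) : ℂ) := by
    intro x y
    rw [← hRR, mul_apply_eq_comp, ← ContinuousLinearMap.adjoint_inner_left, hRadj]
  have hR1 : ∑' i, ‖R (onb H i)‖ₑ ^ 2 = 1 := by
    have h2 : HasSum (fun i => ‖R (onb H i)‖ ^ 2) 1 := by
      rw [← Complex.hasSum_ofReal]
      convert! hsum using 1
      · ext i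
        rw [hinner, inner_self_eq_norm_sq_to_K]; simp
    have h3 := ENNReal.ofReal_tsum_of_nonneg (fun i => by positivity) h2.summable
    rw [h2.tsum_eq] at h3
    simpa [ENNReal.ofReal_pow, ofReal_norm] using h3.symm
  have hRB : ∑' i, ‖R (B (onb H i))‖ₑ ^ 2 ≤ 1 := by
    have h := tsum_enorm_sq_adjoint (onb H) (R * B)
    simp only [mul_apply_eq_comp] at h
    rw [h, ← hR1]
    refine ENNReal.tsum_le_tsum fun i => ?_
    rw [ContinuousLinearMap.mul_def, ContinuousLinearMap.adjoint_comp, hRadj]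
    gcongr
    rw [ContinuousLinearMap.comp_apply, enorm_le_iff_norm_le]
    refine (ContinuousLinearMap.le_opNorm _ _).trans ?_
    rw [LinearIsometryEquiv.norm_map]
    exact mul_le_of_le_one_left (norm_nonneg _) hB
  calc ∑' i, ‖(inner ℂ (onb H i) ((S * B) (onb H i)) : ℂ)‖ₑ
      ≤ ∑' i, (‖R (onb H i)‖ₑ ^ 2 + ‖R (B (onb H i))‖ₑ ^ 2) / 2 := by
        refine ENNReal.tsum_le_tsum fun i => ?_
        rw [mul_apply_eq_comp, hinner]
        exact enorm_inner_le_half_add_sq _ _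
    _ = (∑' i, ‖R (onb H i)‖ₑ ^ 2 + ∑' i, ‖R (B (onb H i))‖ₑ ^ 2) / 2 := by
        simp_rw [div_eq_mul_inv]
        rw [ENNReal.tsum_mul_right, ENNReal.tsum_add]
    _ ≤ (1 + 1) / 2 := by gcongr; exact hR1.le
    _ = 1 := by rw [one_add_one_eq_two, ENNReal.div_self two_ne_zero ENNReal.ofNat_ne_top]

theorem IsProbabilityOperator.norm_trace_mul_le {S : H →L[ℂ] H}
    (hS : IsProbabilityOperator S) {B : H →L[ℂ] H} (hB : ‖B‖ ≤ 1) :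
    ‖trace (S * B)‖ ≤ 1 := by
  have h := hS.tsum_enorm_inner_mul_le hB
  have h1 : ‖trace (S * B)‖ₑ ≤ 1 := enorm_tsum_le_tsum_enorm.trans h
  simpa using enorm_le_iff_norm_le (y := (1 : ℝ)) |>.1 (by simpa using h1)

theorem trace_rankOne_mul (ψ : H) (B : H →L[ℂ] H) :
    trace (InnerProductSpace.rankOne ℂ ψ ψ * B) = inner ℂ ψ (B ψ) := by
  rw [← ContinuousLinearMap.adjoint_inner_left, ← (onb H).tsum_inner_mul_inner]
  refine tsum_congr fun i => ?_
  simp [ContinuousLinearMap.adjoint_inner_left]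

theorem isProbabilityOperator_rankOne {ψ : H} (hψ : ‖ψ‖ = 1) :
    IsProbabilityOperator (InnerProductSpace.rankOne ℂ ψ ψ) := by
  refine ⟨InnerProductSpace.isPositive_rankOne_self ψ, ?_⟩
  have h := (onb H).hasSum_inner_mul_inner ψ ψ
  rw [inner_self_eq_norm_sq_to_K, hψ] at h
  simpa [inner_smul_right] using h

theorem countable_basisIndex [TopologicalSpace.SeparableSpace H] : Countable (basisIndex H) :=
  (onb H).orthonormal.countable_of_separableSpace

/-- The trace against a probability operator commutes with weak integrals of contractions. -/
theorem IsProbabilityOperator.trace_mul_eq_integral [TopologicalSpace.SeparableSpace H]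
    {α : Type*} [MeasurableSpace α] {μ : Measure α}
    {S : H →L[ℂ] H} (hS : IsProbabilityOperator S) {W : α → H →L[ℂ] H} {f : α → ℂ} {B : H →L[ℂ] H}
    (hf : Integrable f μ) (hW : ∀ z, ‖W z‖ ≤ 1)
    (hWm : ∀ x, AEStronglyMeasurable (fun z => W z x) μ)
    (hB : ∀ x, B x = ∫ z, f z • W z x ∂μ) :
    trace (S * B) = ∫ z, f z * trace (S * W z) ∂μ := by
  have := countable_basisIndex (H := H)
  have hint : ∀ x, Integrable (fun z => f z • W z x) μ := fun x =>
    (hf.norm.mul_const ‖x‖).mono' (hf.aestronglyMeasurable.smul (hWm x))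
      (.of_forall fun z => by
        rw [norm_smul]
        gcongr
        exact ((W z).le_opNorm x).trans (mul_le_of_le_one_left (norm_nonneg _) (hW z)))
  have hm : ∀ i, AEStronglyMeasurable
      (fun z => f z * (inner ℂ (onb H i) ((S * W z) (onb H i)) : ℂ)) μ := fun i =>
    hf.aestronglyMeasurable.mul <|
      (innerSL ℂ (onb H i) ∘L S).continuous.comp_aestronglyMeasurable (hWm (onb H i))
  simp_rw [trace, ← tsum_mul_left]
  rw [integral_tsum hm]
  · refine tsum_congr fun i => ?_
    rw [mul_apply_eq_comp, hB]
    have h := (innerSL ℂ (onb H i) ∘L S).integral_comp_comm (hint (onb H i))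
    simp only [ContinuousLinearMap.comp_apply, innerSL_apply_apply, map_smul] at h
    simpa only [mul_apply_eq_comp, smul_eq_mul] using h.symm
  · rw [← lintegral_tsum fun i => (hm i).enorm]
    refine ((lintegral_mono fun z => ?_).trans_lt hf.2).ne
    simp_rw [enorm_mul]
    rw [ENNReal.tsum_mul_left]
    exact mul_le_of_le_one_right' (hS.tsum_enorm_inner_mul_le (hW z))

end Trace

/-! ### Gaussians on the phase plane -/

section Plane

/-- The symplectic form `x y' - y x'` of the plane. -/
def planeSymp (z w : Fin 2 → ℝ) : ℝ := z 0 * w 1 - z 1 * w 0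

/-- The Gaussian `e^{-|z|²/4}`, the characteristic function of the vacuum state. -/
noncomputable def gauss (z : Fin 2 → ℝ) : ℂ := Complex.exp (-(1 / 4) * ∑ i, (z i : ℂ) ^ 2)

/-- The weight `(2π)⁻¹ e^{-|z|²/4}`. -/
noncomputable def vacuumKernel (z : Fin 2 → ℝ) : ℂ := (2 * Real.pi : ℂ)⁻¹ * gauss z

theorem gauss_zero : gauss 0 = 1 := by simp [gauss]

theorem gauss_neg (z : Fin 2 → ℝ) : gauss (-z) = gauss z := by simp [gauss]

theorem gauss_eq_ofReal (z : Fin 2 → ℝ) :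
    gauss z = (Real.exp (-(1 / 4) * ∑ i, z i ^ 2) : ℝ) := by simp [gauss]

theorem conj_gauss (z : Fin 2 → ℝ) : (starRingEnd ℂ) (gauss z) = gauss z := by
  rw [gauss_eq_ofReal, Complex.conj_ofReal]

theorem continuous_gauss : Continuous gauss := by unfold gauss; fun_prop

theorem integrable_gauss : Integrable gauss := by
  have h := GaussianFourier.integrable_cexp_neg_mul_sum_add (b := 1 / 4) (by norm_num)
    (0 : Fin 2 → ℂ)
  simp only [Pi.zero_apply, zero_mul, Finset.sum_const_zero, add_zero] at h
  exact h

theorem continuous_vacuumKernel : Continuous vacuumKernel := continuous_const.mul continuous_gauss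

theorem integrable_vacuumKernel : Integrable vacuumKernel := integrable_gauss.const_mul _

theorem conj_vacuumKernel (z : Fin 2 → ℝ) :
    (starRingEnd ℂ) (vacuumKernel z) = vacuumKernel z := by
  simp [vacuumKernel, conj_gauss, Complex.conj_ofNat]

theorem vacuumKernel_neg (z : Fin 2 → ℝ) : vacuumKernel (-z) = vacuumKernel z := by
  simp [vacuumKernel, gauss_neg]

/-- The Gaussian integral that makes the smeared Weyl operator a projection: a twisted
convolution of two Gaussians, shifted by `w`, is again a Gaussian. -/
theorem integral_phase_mul_vacuumKernel_mul_vacuumKernel (v w : Fin 2 → ℝ) :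
    ∫ z, Complex.exp (Complex.I / 2 * (planeSymp z w : ℂ)) *
      Complex.exp (Complex.I / 2 * (planeSymp (z + w) (v - (w + z)) : ℂ)) *
      (vacuumKernel z * vacuumKernel (v - (w + z))) = gauss w * vacuumKernel v := by
  -- The exponent as a function of `z`: quadratic part `-|z|²/2` and the linear coefficients below,
  -- which depend on `v - w` through the Gaussians and on `v + w` through the phases.
  have h := GaussianFourier.integral_cexp_neg_mul_sum_add (b := 1 / 2) (by norm_num)
    (![((v 0 - w 0 : ℝ) : ℂ) / 2 + Complex.I / 2 * (w 1 + v 1 : ℝ),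
      ((v 1 - w 1 : ℝ) : ℂ) / 2 - Complex.I / 2 * (w 0 + v 0 : ℝ)])
  have h2 := congrArg (fun t => ((2 * Real.pi : ℂ)⁻¹ * (2 * Real.pi : ℂ)⁻¹ * Complex.exp
    (-(1 / 4) * ((v 0 - w 0) ^ 2 + (v 1 - w 1) ^ 2 : ℂ)
      + Complex.I / 2 * (planeSymp w v : ℂ))) * t) h
  simp only [← integral_const_mul] at h2
  convert! h2 using 1
  · congr 1
    ext z
    simp only [vacuumKernel, gauss]
    have e : ∀ K p q r t : ℂ, Complex.exp p * Complex.exp q *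
        (K * Complex.exp r * (K * Complex.exp t)) = K * K * Complex.exp (p + q + (r + t)) := by
      intro K p q r t
      simp only [Complex.exp_add]; ring
    rw [e, mul_assoc _ (Complex.exp _) (Complex.exp _), ← Complex.exp_add]
    congr 2
    simp [planeSymp, Fin.sum_univ_two]
    ring
  · have e : ((Real.pi : ℂ) / (1 / 2)) ^ ((Fintype.card (Fin 2) : ℂ) / 2) = 2 * Real.pi := by
      simp; ring
    rw [e, vacuumKernel, gauss, gauss]
    have e2 : ∀ a b : ℂ, (2 * Real.pi : ℂ)⁻¹ * (2 * Real.pi : ℂ)⁻¹ * Complex.exp a *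
        (2 * Real.pi * Complex.exp b) = (2 * Real.pi : ℂ)⁻¹ * Complex.exp (a + b) := by
      intro a b
      rw [Complex.exp_add]; field_simp
    rw [e2, mul_left_comm, ← Complex.exp_add]
    congr 2
    simp [planeSymp, Fin.sum_univ_two]
    ring_nf
    simp [Complex.I_sq]
    ring

end Plane

/-! ### Weyl systems in one degree of freedom and their vacuum -/

section WeylSystem

variable {H : Type*} [NormedAddCommGroup H] [InnerProductSpace ℂ H] [CompleteSpace H]

/-- A strongly continuous family of unitaries over the plane that satisfies the Weyl–Segal
relations for one degree of freedom; irreducibility is not required. -/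
structure IsWeylSystem (W : (Fin 2 → ℝ) → H →L[ℂ] H) : Prop where
  mem_unitary : ∀ z, W z ∈ unitary (H →L[ℂ] H)
  weyl_segal : ∀ z w, W z * W w = Complex.exp (Complex.I / 2 * (planeSymp z w : ℂ)) • W (z + w)
  continuous : ∀ x : H, Continuous fun z => W z x

namespace IsWeylSystem

variable {W : (Fin 2 → ℝ) → H →L[ℂ] H}

theorem apply_apply (hW : IsWeylSystem W) (z w : Fin 2 → ℝ) (x : H) :
    W z (W w x) = Complex.exp (Complex.I / 2 * (planeSymp z w : ℂ)) • W (z + w) x := by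
  rw [← mul_apply_eq_comp, hW.weyl_segal]; rfl

theorem norm_apply (hW : IsWeylSystem W) (z : Fin 2 → ℝ) (x : H) : ‖W z x‖ = ‖x‖ :=
  ContinuousLinearMap.norm_map_of_mem_unitary (hW.mem_unitary z) x

theorem norm_le_one (hW : IsWeylSystem W) (z : Fin 2 → ℝ) : ‖W z‖ ≤ 1 :=
  ContinuousLinearMap.opNorm_le_bound _ zero_le_one fun x => by rw [hW.norm_apply, one_mul]

theorem map_zero (hW : IsWeylSystem W) : W 0 = 1 := by
  have h := hW.weyl_segal 0 0
  simp only [planeSymp, Pi.zero_apply, mul_zero, sub_zero, Complex.ofReal_zero, Complex.exp_zero,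
    one_smul, add_zero] at h
  have h1 := Unitary.star_mul_self_of_mem (hW.mem_unitary 0)
  calc W 0 = star (W 0) * W 0 * W 0 := by rw [h1, one_mul]
    _ = 1 := by rw [mul_assoc, h, h1]

theorem inner_apply_left (hW : IsWeylSystem W) (z : Fin 2 → ℝ) (x y : H) :
    inner ℂ (W z x) y = (inner ℂ x (W (-z) y) : ℂ) := by
  rw [← ContinuousLinearMap.inner_map_map_of_mem_unitary (hW.mem_unitary z) x, hW.apply_apply]
  have : planeSymp z (-z) = 0 := by simp [planeSymp]; ring
  simp [this, hW.map_zero]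

theorem integrable_smul_apply (hW : IsWeylSystem W) (x : H) :
    Integrable fun z => vacuumKernel z • W z x :=
  (integrable_vacuumKernel.norm.mul_const ‖x‖).mono'
    (continuous_vacuumKernel.smul (hW.continuous x)).aestronglyMeasurable
    (.of_forall fun z => by rw [norm_smul, hW.norm_apply])

/-- The smeared Weyl operator `(2π)⁻¹ ∫ e^{-|z|²/4} W(z) dz`, as a strong integral. It is the
orthogonal projection onto the vacuum vectors of the Weyl system. -/
noncomputable def vacuumProj (hW : IsWeylSystem W) : H →L[ℂ] H :=
  LinearMap.mkContinuous
    { toFun := fun x => ∫ z, vacuumKernel z • W z x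
      map_add' := fun x y => by
        simp_rw [map_add, smul_add]
        exact integral_add (hW.integrable_smul_apply x) (hW.integrable_smul_apply y)
      map_smul' := fun c x => by
        simp_rw [map_smul, smul_comm _ c]
        exact integral_smul c _ }
    (∫ z, ‖vacuumKernel z‖) fun x => by
      refine (norm_integral_le_integral_norm _).trans_eq ?_
      rw [← integral_mul_const]
      simp_rw [norm_smul, hW.norm_apply]

theorem vacuumProj_apply (hW : IsWeylSystem W) (x : H) :
    hW.vacuumProj x = ∫ z, vacuumKernel z • W z x := rfl

/-- Von Neumann's identity `P W(w) P = e^{-|w|²/4} P`. -/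
theorem vacuumProj_apply_apply_vacuumProj (hW : IsWeylSystem W) (w : Fin 2 → ℝ) (y : H) :
    hW.vacuumProj (W w (hW.vacuumProj y)) = gauss w • hW.vacuumProj y := by
  set F : (Fin 2 → ℝ) → (Fin 2 → ℝ) → ℂ := fun z v =>
    Complex.exp (Complex.I / 2 * (planeSymp z w : ℂ)) *
      Complex.exp (Complex.I / 2 * (planeSymp (z + w) (v - (w + z)) : ℂ)) *
      (vacuumKernel z * vacuumKernel (v - (w + z))) with hF
  have hFc : Continuous (Function.uncurry fun z v => F z v • W v y) := by
    have h1 : Continuous fun p : (Fin 2 → ℝ) × (Fin 2 → ℝ) => F p.1 p.2 := by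
      have := continuous_vacuumKernel
      simp only [hF, planeSymp]
      fun_prop
    exact h1.smul ((hW.continuous y).comp continuous_snd)
  have hFi : Integrable (Function.uncurry fun z v => F z v • W v y) (volume.prod volume) := by
    have h1 := (integrable_vacuumKernel.convolution_integrand (ContinuousLinearMap.mul ℂ ℂ)
      (integrable_vacuumKernel.comp_sub_right w)).swap
    refine (h1.norm.mul_const ‖y‖).mono' hFc.aestronglyMeasurable (.of_forall fun p => ?_)
    have hph : ∀ t : ℝ, ‖Complex.exp (Complex.I / 2 * (t : ℂ))‖ = 1 := fun t => by
      rw [show Complex.I / 2 * (t : ℂ) = ((t / 2 : ℝ) : ℂ) * Complex.I by push_cast; ring,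
        Complex.norm_exp_ofReal_mul_I]
    simp [Function.uncurry, hF, norm_smul, hW.norm_apply, hph, sub_add_eq_sub_sub_swap]
  calc hW.vacuumProj (W w (hW.vacuumProj y))
      = ∫ z, ∫ z', (vacuumKernel z * vacuumKernel z') • W z (W w (W z' y)) := by
        rw [vacuumProj_apply]
        refine integral_congr_ae (.of_forall fun z => ?_)
        have h := (W z ∘L W w).integral_comp_comm (hW.integrable_smul_apply y)
        simp only [ContinuousLinearMap.comp_apply, map_smul] at h
        simp only [mul_smul, vacuumProj_apply, ← h]
        rw [integral_smul]
    _ = ∫ z, ∫ v, F z v • W v y := by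
        -- substitute `v = z + w + z'`
        refine integral_congr_ae (.of_forall fun z => ?_)
        simp only
        rw [← integral_sub_right_eq_self _ (w + z)]
        refine integral_congr_ae (.of_forall fun v => ?_)
        simp only [hF]
        rw [hW.apply_apply z, hW.apply_apply, smul_smul, smul_smul,
          show z + w + (v - (w + z)) = v by abel]
        congr 1
        ring
    _ = ∫ v, (∫ z, F z v) • W v y := by
        rw [integral_integral_swap hFi]
        simp_rw [integral_smul_const]
    _ = gauss w • hW.vacuumProj y := by
        simp_rw [hF, integral_phase_mul_vacuumKernel_mul_vacuumKernel, mul_smul]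
        rw [integral_smul, vacuumProj_apply]

theorem vacuumProj_vacuumProj (hW : IsWeylSystem W) (y : H) :
    hW.vacuumProj (hW.vacuumProj y) = hW.vacuumProj y := by
  simpa [hW.map_zero, gauss_zero] using hW.vacuumProj_apply_apply_vacuumProj 0 y

theorem inner_vacuumProj_right (hW : IsWeylSystem W) (x y : H) :
    inner ℂ x (hW.vacuumProj y) = (∫ z, vacuumKernel z * inner ℂ x (W z y) : ℂ) := by
  rw [vacuumProj_apply, ← integral_inner (hW.integrable_smul_apply y)]
  simp_rw [inner_smul_right]

theorem inner_vacuumProj_left (hW : IsWeylSystem W) (x y : H) :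
    inner ℂ (hW.vacuumProj x) y = (inner ℂ x (hW.vacuumProj y) : ℂ) := by
  rw [← inner_conj_symm, inner_vacuumProj_right, inner_vacuumProj_right, ← integral_conj,
    ← integral_neg_eq_self]
  refine integral_congr_ae (.of_forall fun z => ?_)
  simp only [map_mul, conj_vacuumKernel, inner_conj_symm, vacuumKernel_neg, hW.inner_apply_left,
    neg_neg]

theorem norm_vacuumProj_le (hW : IsWeylSystem W) : ‖hW.vacuumProj‖ ≤ 1 := by
  refine ContinuousLinearMap.opNorm_le_bound _ zero_le_one fun x => ?_
  have h : ‖hW.vacuumProj x‖ ^ 2 ≤ ‖x‖ * ‖hW.vacuumProj x‖ := by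
    have h1 := norm_inner_le_norm (𝕜 := ℂ) x (hW.vacuumProj x)
    rwa [← hW.vacuumProj_vacuumProj x, ← hW.inner_vacuumProj_left, inner_self_eq_norm_sq_to_K,
      norm_pow, hW.vacuumProj_vacuumProj, RCLike.norm_ofReal, abs_norm] at h1
  rw [one_mul]
  by_contra! hlt
  nlinarith [norm_nonneg x]

/-- The smeared operator `P` does not vanish: the expectations of its conjugates `W(u)* P W(u)` in
a vector `x` form the Fourier transform of `z ↦ (2π)⁻¹ e^{-|z|²/4} ⟨x, W(z) x⟩`, which is
`(2π)⁻¹ ‖x‖²` at the origin. -/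
theorem vacuumProj_ne_zero [Nontrivial H] (hW : IsWeylSystem W) : hW.vacuumProj ≠ 0 := by
  intro h0
  obtain ⟨x, hx⟩ := exists_ne (0 : H)
  let f : EuclideanSpace ℝ (Fin 2) → ℂ := fun z => vacuumKernel z.ofLp * inner ℂ x (W z.ofLp x)
  have hfc : Continuous f := by
    have h1 := continuous_vacuumKernel
    have h2 := hW.continuous x
    have h3 : Continuous fun z : EuclideanSpace ℝ (Fin 2) => z.ofLp := by fun_prop
    exact (h1.comp h3).mul (Continuous.inner continuous_const (h2.comp h3))
  have hmp := PiLp.volume_preserving_ofLp (Fin 2)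
  have hemb : MeasurableEmbedding (fun z : EuclideanSpace ℝ (Fin 2) => z.ofLp) :=
    (MeasurableEquiv.toLp 2 (Fin 2 → ℝ)).symm.measurableEmbedding
  have hfi : Integrable f := by
    have h : Integrable fun z => vacuumKernel z * inner ℂ x (W z x) := by
      simpa [inner_smul_right] using (hW.integrable_smul_apply x).const_inner (𝕜 := ℂ) x
    exact (hmp.integrable_comp_emb hemb).2 h
  have hF : FourierTransform.fourier f = 0 := by
    ext ξ
    rw [Real.fourier_eq']
    -- `u` is chosen so that `planeSymp z u = -2π ⟨z, ξ⟩`.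
    set u : Fin 2 → ℝ := ![2 * Real.pi * ξ 1, -(2 * Real.pi * ξ 0)] with hu
    have h1 := hW.inner_vacuumProj_right (W u x) (W u x)
    rw [h0] at h1
    simp only [zero_apply, inner_zero_right] at h1
    rw [Pi.zero_apply, h1, ← hmp.integral_comp hemb]
    refine integral_congr_ae (.of_forall fun z => ?_)
    simp only [f]
    rw [hW.inner_apply_left, hW.apply_apply z.ofLp, map_smul, hW.apply_apply, smul_smul,
      inner_smul_right, ← Complex.exp_add, show -u + (z.ofLp + u) = z.ofLp by abel, smul_eq_mul,
      mul_left_comm]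
    congr 3
    simp [planeSymp, hu, PiLp.inner_apply, Fin.sum_univ_two]
    ring
  have hinv := hfc.fourierInv_fourier_eq hfi (by rw [hF]; exact integrable_zero _ _ _)
  have h2 : f 0 = 0 := by
    rw [← hinv, hF, Real.fourierInv_eq']
    simp
  simp [f, vacuumKernel, gauss_zero, hW.map_zero, hx] at h2

/-- A one-mode Weyl system has a vacuum vector: any unit vector in the range of `vacuumProj`. -/
theorem exists_vacuum [Nontrivial H] (hW : IsWeylSystem W) :
    ∃ ψ : H, ‖ψ‖ = 1 ∧ ∀ w, inner ℂ ψ (W w ψ) = gauss w := by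
  obtain ⟨x, hx⟩ : ∃ x, hW.vacuumProj x ≠ 0 := by
    by_contra! h
    exact hW.vacuumProj_ne_zero (ContinuousLinearMap.ext h)
  obtain ⟨c, hc⟩ : ∃ c : ℂ, ‖c • hW.vacuumProj x‖ = 1 :=
    ⟨((‖hW.vacuumProj x‖⁻¹ : ℝ) : ℂ), by
      rw [norm_smul, Complex.norm_real, norm_inv, norm_norm,
        inv_mul_cancel₀ (norm_ne_zero_iff.2 hx)]⟩
  refine ⟨_, hc, fun w => ?_⟩
  rw [← map_smul] at hc ⊢
  set y := c • x
  rw [hW.inner_vacuumProj_left, hW.vacuumProj_apply_apply_vacuumProj, inner_smul_right,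
    ← hW.vacuumProj_vacuumProj y, ← hW.inner_vacuumProj_left, inner_self_eq_norm_sq_to_K, hc]
  simp

end IsWeylSystem

end WeylSystem

/-! ### The uncertainty bound and the modes of the phase space -/

section Limit

variable {H : Type*} [NormedAddCommGroup H] [InnerProductSpace ℂ H] [CompleteSpace H]

/-- The uncertainty relation for Gaussian characteristic functions: if `tr (S W(w))` is
`e^{-c|w|²/4}`, then `tr (S P) = 2 / (1 + c)` for the vacuum projection `P`, and this trace is at
most one. -/
theorem IsWeylSystem.one_le_of_trace_eq_gaussian [TopologicalSpace.SeparableSpace H]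
    {W : (Fin 2 → ℝ) → H →L[ℂ] H} (hW : IsWeylSystem W) {S : H →L[ℂ] H}
    (hS : IsProbabilityOperator S) {c : ℝ} (hc : 0 ≤ c)
    (h : ∀ w, trace (S * W w) = Complex.exp (-(c / 4) * ∑ i, (w i : ℂ) ^ 2)) : 1 ≤ c := by
  have hle := hS.norm_trace_mul_le hW.norm_vacuumProj_le
  have hint := hS.trace_mul_eq_integral integrable_vacuumKernel hW.norm_le_one
    (fun x => (hW.continuous x).aestronglyMeasurable) hW.vacuumProj_apply
  have hc1 : (1 + c : ℂ) ≠ 0 := by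
    have : (1 + c : ℝ) ≠ 0 := by positivity
    exact_mod_cast this
  have hb : 0 < (((1 + c) / 4 : ℝ) : ℂ).re := by rw [Complex.ofReal_re]; positivity
  have hg := GaussianFourier.integral_cexp_neg_mul_sum_add hb (0 : Fin 2 → ℂ)
  have hval : trace (S * hW.vacuumProj) = ((2 / (1 + c) : ℝ) : ℂ) := by
    rw [hint]
    have e : ∀ z : Fin 2 → ℝ, vacuumKernel z * trace (S * W z) = (2 * Real.pi : ℂ)⁻¹ *
        Complex.exp (-(((1 + c) / 4 : ℝ) : ℂ) * ∑ i, (z i : ℂ) ^ 2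
          + ∑ i, (0 : Fin 2 → ℂ) i * z i) := by
      intro z
      rw [h, vacuumKernel, gauss, mul_assoc, ← Complex.exp_add]
      congr 2
      simp
      ring
    simp_rw [e]
    rw [integral_const_mul, hg]
    simp
    field_simp
    norm_num
  rw [hval, Complex.norm_real, Real.norm_of_nonneg (by positivity),
    div_le_one (by positivity)] at hle
  linarith

/-- The inclusion of the phase plane of the `k`-th mode. -/
def modeEmbed {d : ℕ} (k : Fin d) (w : Fin 2 → ℝ) : PhaseSpace d :=
  fun p => if p.1 = k then w p.2 else 0

theorem modeEmbed_add {d : ℕ} (k : Fin d) (w w' : Fin 2 → ℝ) :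
    modeEmbed k (w + w') = modeEmbed k w + modeEmbed k w' := by
  ext p
  by_cases h : p.1 = k <;> simp [modeEmbed, h]

theorem continuous_modeEmbed {d : ℕ} (k : Fin d) : Continuous (modeEmbed k) := by
  refine continuous_pi fun p => ?_
  by_cases h : p.1 = k <;> simp only [modeEmbed, h, if_true, if_false] <;> fun_prop

theorem symp_modeEmbed {d : ℕ} (k : Fin d) (w w' : Fin 2 → ℝ) :
    symp (modeEmbed k w) (modeEmbed k w') = planeSymp w w' := by
  rw [symp, Finset.sum_eq_single k]
  · simp [modeEmbed, planeSymp]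
  · intro j _ hj; simp [modeEmbed, hj]
  · simp

theorem normingMatrix_mulVec_modeEmbed {d : ℕ} (a : Fin d → ℝ) (k : Fin d) (w : Fin 2 → ℝ) :
    (normingMatrix a).mulVec (modeEmbed k w) = modeEmbed k (a k • w) := by
  ext p
  rw [normingMatrix, Matrix.mulVec_diagonal]
  by_cases h : p.1 = k <;> simp [modeEmbed, h]

theorem IsIrreducibleWeylRep.isWeylSystem_mode {d : ℕ} {V : PhaseSpace d → H →L[ℂ] H}
    (hV : IsIrreducibleWeylRep V) (k : Fin d) : IsWeylSystem fun w => V (modeEmbed k w) where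
  mem_unitary _ := hV.mem_unitary _
  weyl_segal z w := by rw [hV.weyl_segal, symp_modeEmbed, modeEmbed_add]
  continuous x := (hV.continuous x).comp (continuous_modeEmbed k)

theorem gauss_smul_pow (a : ℝ) (n : ℕ) (w : Fin 2 → ℝ) :
    gauss (a • w) ^ n =
      Complex.exp (-(((n * a ^ 2 : ℝ) : ℂ) / 4) * ∑ i, (w i : ℂ) ^ 2) := by
  rw [gauss, ← Complex.exp_nat_mul]
  congr 1
  simp
  ring

end Limit

end QuantumLimit

theorem mainTheorem2 {H : Type*} [NormedAddCommGroup H] [InnerProductSpace ℂ H] [CompleteSpace H]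
    [TopologicalSpace.SeparableSpace H] {d : ℕ}
    (V : QuantumLimit.PhaseSpace d → H →L[ℂ] H) (hV : QuantumLimit.IsIrreducibleWeylRep V)
    (a : ℕ → Fin d → ℝ) (ha : ∀ n : ℕ, 1 ≤ n → ∀ k : Fin d, 0 ≤ a n k)
    (hA : QuantumLimit.IsAdmissible V fun n => QuantumLimit.normingMatrix (a n)) :
    ∀ n : ℕ, 1 ≤ n → ∀ k : Fin d, 1 / Real.sqrt n ≤ a n k := by
  intro n hn k
  have := hV.nontrivial
  have hW := hV.isWeylSystem_mode k
  obtain ⟨ψ, hψ, hvac⟩ := hW.exists_vacuum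
  obtain ⟨S, hS, hchar⟩ := hA n hn (fun _ => InnerProductSpace.rankOne ℂ ψ ψ)
    fun _ => QuantumLimit.isProbabilityOperator_rankOne hψ
  have hc : 1 ≤ n * a n k ^ 2 := by
    refine hW.one_le_of_trace_eq_gaussian hS (by positivity) fun w => ?_
    have h := hchar (QuantumLimit.modeEmbed k w)
    simp only [QuantumLimit.charFn, QuantumLimit.normingMatrix_mulVec_modeEmbed,
      QuantumLimit.trace_rankOne_mul, hvac, Finset.prod_const, Finset.card_univ,
      Fintype.card_fin] at h
    rw [h, QuantumLimit.gauss_smul_pow]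
  have hn0 : (0 : ℝ) < n := by exact_mod_cast hn
  rw [div_le_iff₀ (Real.sqrt_pos.2 hn0)]
  refine (sq_le_sq₀ zero_le_one (mul_nonneg (ha n hn k) (Real.sqrt_nonneg _))).1 ?_
  rw [mul_pow, Real.sq_sqrt hn0.le]
  linarith
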